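/- There is an absolute constant $C>0$ with the following property. Let $X,Y,A,B$ be discrete random variables (with finite or countable alphabets) that are defined on a common probability space and whose joint Shannon entropy $H(X,Y,A,B)$ is finite, and let $\epsilon\ge 0$ be a real number such that \[ \max\{I(A:X|Y),\,I(A:Y|X)\}\le \epsilon\cdot I(X:Y). \] Then \[ I(X:Y)\le I(X:Y|A)+I(X:Y|B)+I(A:B)+C\sqrt{\epsilon}\cdot I(X:Y). \] Here $I(X:Y)=H(X)-H(X|Y)$ and $I(X:Y|Z)=H(X|Z)-H(X|Y,Z)$ are the mutual information and the conditional mutual information, where $H(X|Y)=H(X,Y)-H(Y)$ and $H$ is Shannon entropy. -/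

import Mathlib

open MeasureTheory

namespace DiscreteEntropy

noncomputable section

/-- The joint random variable `(X, Y)`. -/
def joint {Ω S T : Type*} (X : Ω → S) (Y : Ω → T) : Ω → S × T := fun ω => (X ω, Y ω)

/-- `X` has finite Shannon entropy: the series `∑ x, -P(X = x) log P(X = x)`, whose terms are
nonnegative, converges. -/
def HasFiniteEntropy {Ω S : Type*} [MeasurableSpace Ω] (μ : Measure Ω) (X : Ω → S) : Prop :=
  Summable fun x : S => Real.negMulLog (μ.real (X ⁻¹' {x}))

/-- Shannon entropy `H(X) = ∑ x, -P(X = x) log P(X = x)` (natural logarithm) of a discrete random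
variable of finite entropy. -/
def entropy {Ω S : Type*} [MeasurableSpace Ω] (μ : Measure Ω) (X : Ω → S) : ℝ :=
  ∑' x : S, Real.negMulLog (μ.real (X ⁻¹' {x}))

/-- Conditional entropy `H(X | Y) = H(X, Y) - H(Y)`. -/
def condEntropy {Ω S T : Type*} [MeasurableSpace Ω] (μ : Measure Ω) (X : Ω → S) (Y : Ω → T) : ℝ :=
  entropy μ (joint X Y) - entropy μ Y

/-- Mutual information `I(X : Y) = H(X) - H(X | Y)`. -/
def mutualInfo {Ω S T : Type*} [MeasurableSpace Ω] (μ : Measure Ω) (X : Ω → S) (Y : Ω → T) : ℝ :=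
  entropy μ X - condEntropy μ X Y

/-- Conditional mutual information `I(X : Y | Z) = H(X | Z) - H(X | Y, Z)`. -/
def condMutualInfo {Ω S T U : Type*} [MeasurableSpace Ω] (μ : Measure Ω)
    (X : Ω → S) (Y : Ω → T) (Z : Ω → U) : ℝ :=
  condEntropy μ X Z - condEntropy μ X (joint Y Z)

end

end DiscreteEntropy

set_option linter.unusedSectionVars false

namespace DiscreteEntropy

/-! The bound comes from Matúš's infinite family of non-Shannon inequalities by optimizing the index
`n`. Extend the space by copies `A₁, A₂, …` of `A`, independent given `(X, Y)` and jointly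
independent of `(A, B)` given `(X, Y)`, and write `Z_k` for the first `k` copies. A Shannon-type
computation (`mutualInfo_le_of_condIndep`) gives, for every `k`, `I(X:Y) ≤ I(X:Y|A) + I(X:Y|B) +
I(A:B) + [I(X:Y|Z_k) - I(X:Y|Z_k,A)] + I(Z_k:X|Y) + I(Z_k:Y|X)`.

Given `(X, Y)`, the variable `A` is itself one more independent sample, so `(X, Y, Z_k, A)` has the
law of `(X, Y, Z_{k+1})` (`map_joint_firstCopies_succ`). Hence the brackets telescope when summed
over `k < n`, leaving at most `I(X:Y)`. The last two terms are subadditive over the copies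
(`condMutualInfo_pair_le`), so they total at most `n(n-1)/2 * (I(A:X|Y) + I(A:Y|X))`. This is
`nsmul_mutualInfo_le`.

With the hypothesis, division by `n` leaves the error `(1/n + (n-1)ε) I(X:Y)`, and `n = ⌈1/√ε⌉`
makes it at most `2√ε I(X:Y)`; for `ε = 0` let `n → ∞`.

On countable alphabets, entropies are treated as integrals of the information content, so linear
relations between entropies follow from almost sure relations once every term is integrable. -/

/-- The information content `-log P(X = X(ω))` of the value of `X` at `ω`. -/
noncomputable def info {Ω S : Type*} [MeasurableSpace Ω] (μ : Measure Ω) (X : Ω → S) (ω : Ω) : ℝ :=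
  -Real.log (μ.real (X ⁻¹' {X ω}))

theorem measurable_joint {Ω S T : Type*} [MeasurableSpace Ω] [MeasurableSpace S]
    [MeasurableSpace T] {X : Ω → S} {Y : Ω → T} (hX : Measurable X) (hY : Measurable Y) :
    Measurable (joint X Y) := hX.prodMk hY

/-! ### Entropy as the integral of information content -/

section Info

variable {Ω S : Type*} [MeasurableSpace Ω] {μ : Measure Ω} [IsProbabilityMeasure μ]
  [Countable S] [MeasurableSpace S] [MeasurableSingletonClass S] {X : Ω → S}

theorem map_real_singleton (hX : Measurable X) (x : S) :
    (μ.map X).real {x} = μ.real (X ⁻¹' {x}) :=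
  map_measureReal_apply hX (measurableSet_singleton x)

theorem measurable_info (hX : Measurable X) : Measurable (info μ X) :=
  (measurable_of_countable fun x => -Real.log (μ.real (X ⁻¹' {x}))).comp hX

theorem info_nonneg (ω : Ω) : 0 ≤ info μ X ω :=
  neg_nonneg.2 (Real.log_nonpos measureReal_nonneg measureReal_le_one)

/-- Under the law of `X`, the information content integrates to a sum over atoms, and its
nonnegativity makes absolute convergence the same as summability of the entropy series. -/
theorem integrable_info_iff (hX : Measurable X) :
    Integrable (info μ X) μ ↔ HasFiniteEntropy μ X := by
  have h : info μ X = (fun x => -Real.log (μ.real (X ⁻¹' {x}))) ∘ X := rfl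
  have := Measure.isProbabilityMeasure_map (μ := μ) hX.aemeasurable
  rw [h, ← integrable_map_measure (measurable_of_countable _).aestronglyMeasurable hX.aemeasurable,
    ← Measure.sum_smul_dirac (μ.map X), integrable_sum_dirac_iff (fun x => measure_ne_top _ _)]
  unfold HasFiniteEntropy
  refine summable_congr fun x => ?_
  have h2 : (μ.map X {x}).toReal = μ.real (X ⁻¹' {x}) := map_real_singleton hX x
  rw [h2, Real.norm_of_nonneg
    (neg_nonneg.2 (Real.log_nonpos measureReal_nonneg measureReal_le_one)), Real.negMulLog]
  ring

theorem entropy_eq_integral_info (hX : Measurable X) (h : HasFiniteEntropy μ X) :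
    entropy μ X = ∫ ω, info μ X ω ∂μ := by
  have h1 := (integrable_info_iff hX).2 h
  have h2 : info μ X = (fun x => -Real.log (μ.real (X ⁻¹' {x}))) ∘ X := rfl
  have hm := (measurable_of_countable fun x => -Real.log (μ.real (X ⁻¹' {x})))
  rw [h2, ← integrable_map_measure hm.aestronglyMeasurable hX.aemeasurable] at h1
  have h3 := integral_map hX.aemeasurable (hm.aestronglyMeasurable (μ := μ.map X))
  rw [integral_countable h1] at h3
  unfold entropy info
  rw [← h3]
  refine tsum_congr fun x => ?_
  rw [map_real_singleton hX, Real.negMulLog, smul_eq_mul]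
  ring

theorem ae_measure_fiber_pos (hX : Measurable X) : ∀ᵐ ω ∂μ, 0 < μ.real (X ⁻¹' {X ω}) := by
  have : ∀ᵐ x ∂μ.map X, 0 < μ.real (X ⁻¹' {x}) := by
    rw [ae_iff_of_countable]
    intro x hx
    rw [Measure.map_apply hX (measurableSet_singleton x)] at hx
    exact ENNReal.toReal_pos hx (measure_ne_top _ _)
  exact ae_of_ae_map hX.aemeasurable this

end Info

/-! ### Variables that are functions of one another -/

section Determined

variable {Ω S T : Type*} [MeasurableSpace Ω] {μ : Measure Ω} [IsProbabilityMeasure μ]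
  {X : Ω → S} {Y : Ω → T}

theorem fiber_subset (h : ∀ ω ω', X ω = X ω' → Y ω = Y ω') (ω : Ω) :
    X ⁻¹' {X ω} ⊆ Y ⁻¹' {Y ω} := fun ω' hω' => h ω' ω hω'

variable [Countable S] [MeasurableSpace S] [MeasurableSingletonClass S]
  [Countable T] [MeasurableSpace T] [MeasurableSingletonClass T]

/-- A finer variable has smaller fibers. Positivity of the fiber, which holds only almost surely, is
needed because `Real.log 0 = 0`. -/
theorem info_le_of_determined (hX : Measurable X) (h : ∀ ω ω', X ω = X ω' → Y ω = Y ω') :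
    ∀ᵐ ω ∂μ, info μ Y ω ≤ info μ X ω := by
  filter_upwards [ae_measure_fiber_pos hX] with ω hω
  exact neg_le_neg (Real.log_le_log hω (measureReal_mono (fiber_subset h ω)))

theorem HasFiniteEntropy.of_determined (hf : HasFiniteEntropy μ X) (hX : Measurable X)
    (hY : Measurable Y) (h : ∀ ω ω', X ω = X ω' → Y ω = Y ω') : HasFiniteEntropy μ Y := by
  rw [← integrable_info_iff hX] at hf
  rw [← integrable_info_iff hY]
  refine hf.mono (measurable_info hY).aestronglyMeasurable ?_
  filter_upwards [info_le_of_determined (μ := μ) hX h] with ω hω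
  rwa [Real.norm_of_nonneg (info_nonneg ω), Real.norm_of_nonneg (info_nonneg ω)]

theorem entropy_congr (hf : HasFiniteEntropy μ X) (hX : Measurable X) (hY : Measurable Y)
    (h : ∀ ω ω', X ω = X ω' ↔ Y ω = Y ω') : entropy μ X = entropy μ Y := by
  rw [entropy_eq_integral_info hX hf,
    entropy_eq_integral_info hY (hf.of_determined hX hY fun ω ω' => (h ω ω').1)]
  have : ∀ ω, X ⁻¹' {X ω} = Y ⁻¹' {Y ω} := fun ω =>
    (fiber_subset (fun ω ω' => (h ω ω').1) ω).antisymm (fiber_subset (fun ω ω' => (h ω ω').2) ω)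
  simp only [info, this]

end Determined

/-! ### Submodularity of entropy -/

section Submodularity

variable {Ω S T U : Type*} [MeasurableSpace Ω] {μ : Measure Ω} [IsProbabilityMeasure μ]
  [Countable S] [MeasurableSpace S] [MeasurableSingletonClass S]
  [Countable T] [MeasurableSpace T] [MeasurableSingletonClass T]
  [Countable U] [MeasurableSpace U] [MeasurableSingletonClass U]
  {X : Ω → S} {Y : Ω → T} {Z : Ω → U}

theorem tsum_measure_joint_preimage (hX : Measurable X) (hZ : Measurable Z) (z : U) :
    ∑' x, μ (joint Z X ⁻¹' {(z, x)}) = μ (Z ⁻¹' {z}) := by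
  have hm : ∀ x, MeasurableSet (joint Z X ⁻¹' {(z, x)}) := fun x =>
    (hZ.prodMk hX) (measurableSet_singleton _)
  rw [← measure_iUnion _ hm]
  · congr 1
    ext ω
    simp [joint]
  · intro x x' hne
    refine Set.disjoint_left.2 fun ω h h' => hne ?_
    simp only [joint, Set.mem_preimage, Set.mem_singleton_iff, Prod.mk.injEq] at h h'
    exact h.2.symm.trans h'.2

/-- The integral cancels `p(z,x,y)` and leaves the sum of `p(z,x) p(z,y) / p(z)` over atoms of
positive mass. Extending the sum to all atoms can only increase it, and then it factors for each `z`
into `p(z)² / p(z)`. Working in `ENNReal` avoids questions of summability. -/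
theorem lintegral_density_ratio_le_one (hX : Measurable X) (hY : Measurable Y)
    (hZ : Measurable Z) :
    ∫⁻ ω, μ (joint Z X ⁻¹' {joint Z X ω}) * μ (joint Z Y ⁻¹' {joint Z Y ω}) /
      (μ (joint Z (joint X Y) ⁻¹' {joint Z (joint X Y) ω}) * μ (Z ⁻¹' {Z ω})) ∂μ ≤ 1 := by
  have hW : Measurable (joint Z (joint X Y)) := hZ.prodMk (hX.prodMk hY)
  let g : U × S × T → ENNReal := fun w =>
    μ (joint Z X ⁻¹' {(w.1, w.2.1)}) * μ (joint Z Y ⁻¹' {(w.1, w.2.2)}) /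
      (μ (joint Z (joint X Y) ⁻¹' {w}) * μ (Z ⁻¹' {w.1}))
  change ∫⁻ ω, g (joint Z (joint X Y) ω) ∂μ ≤ 1
  rw [← lintegral_map (measurable_of_countable g) hW, lintegral_countable', ENNReal.tsum_prod']
  calc ∑' z, ∑' p : S × T, g (z, p) * μ.map (joint Z (joint X Y)) {(z, p)}
      ≤ ∑' z, μ (Z ⁻¹' {z}) := ?_
    _ = 1 := by
      rw [← measure_univ (μ := μ), ← Set.preimage_univ (f := Z)]
      rw [← Set.iUnion_of_singleton U, Set.preimage_iUnion, measure_iUnion]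
      · exact fun i j hij => (Set.disjoint_singleton.2 hij).preimage Z
      · exact fun i => hZ (measurableSet_singleton i)
  refine ENNReal.tsum_le_tsum fun z => ?_
  calc ∑' p : S × T, g (z, p) * μ.map (joint Z (joint X Y)) {(z, p)}
      ≤ ∑' p : S × T, μ (joint Z X ⁻¹' {(z, p.1)}) * μ (joint Z Y ⁻¹' {(z, p.2)}) *
          (μ (Z ⁻¹' {z}))⁻¹ := by
        refine ENNReal.tsum_le_tsum fun p => ?_
        rw [Measure.map_apply hW (measurableSet_singleton _)]
        simp only [g]
        set q := μ (joint Z (joint X Y) ⁻¹' {(z, p)}) with hq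
        by_cases h0 : q = 0
        · simp [h0]
        have ht : q ≠ ⊤ := measure_ne_top _ _
        rw [div_eq_mul_inv, ENNReal.mul_inv (Or.inl h0) (Or.inl ht), mul_comm q⁻¹, ← mul_assoc,
          mul_assoc _ q⁻¹, ENNReal.inv_mul_cancel h0 ht, mul_one]
    _ = μ (Z ⁻¹' {z}) * μ (Z ⁻¹' {z}) * (μ (Z ⁻¹' {z}))⁻¹ := by
        rw [ENNReal.tsum_mul_right, ENNReal.tsum_prod']
        simp only [ENNReal.tsum_mul_left, ENNReal.tsum_mul_right,
          tsum_measure_joint_preimage hX hZ, tsum_measure_joint_preimage hY hZ]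
    _ ≤ μ (Z ⁻¹' {z}) := by
        rw [mul_assoc]
        exact mul_le_of_le_one_right' (ENNReal.mul_inv_le_one _)

/-- Gibbs' inequality: with `r = p(z,x) p(z,y) / (p(z,x,y) p(z))`, integrate `log r ≤ r - 1` and use
that `r` has mean at most one. -/
theorem entropy_submodular_joint (hX : Measurable X) (hY : Measurable Y) (hZ : Measurable Z)
    (hf : HasFiniteEntropy μ (joint Z (joint X Y))) :
    entropy μ (joint Z (joint X Y)) + entropy μ Z ≤
      entropy μ (joint Z X) + entropy μ (joint Z Y) := by
  have hW : Measurable (joint Z (joint X Y)) := hZ.prodMk (hX.prodMk hY)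
  have hZX : Measurable (joint Z X) := hZ.prodMk hX
  have hZY : Measurable (joint Z Y) := hZ.prodMk hY
  have fZ : HasFiniteEntropy μ Z := hf.of_determined hW hZ (by simp +contextual [joint])
  have fZX : HasFiniteEntropy μ (joint Z X) := hf.of_determined hW hZX (by simp +contextual [joint])
  have fZY : HasFiniteEntropy μ (joint Z Y) := hf.of_determined hW hZY (by simp +contextual [joint])
  rw [entropy_eq_integral_info hW hf, entropy_eq_integral_info hZ fZ,
    entropy_eq_integral_info hZX fZX, entropy_eq_integral_info hZY fZY]
  have iW := (integrable_info_iff hW).2 hf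
  have iZ := (integrable_info_iff hZ).2 fZ
  have iZX := (integrable_info_iff hZX).2 fZX
  have iZY := (integrable_info_iff hZY).2 fZY
  rw [← integral_add iW iZ, ← integral_add iZX iZY]
  let r : Ω → ENNReal := fun ω =>
    μ (joint Z X ⁻¹' {joint Z X ω}) * μ (joint Z Y ⁻¹' {joint Z Y ω}) /
      (μ (joint Z (joint X Y) ⁻¹' {joint Z (joint X Y) ω}) * μ (Z ⁻¹' {Z ω}))
  have hr1 : ∫⁻ ω, r ω ∂μ ≤ 1 := lintegral_density_ratio_le_one hX hY hZ
  have hrm : Measurable r :=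
    (measurable_of_countable fun w : U × S × T =>
      μ (joint Z X ⁻¹' {(w.1, w.2.1)}) * μ (joint Z Y ⁻¹' {(w.1, w.2.2)}) /
        (μ (joint Z (joint X Y) ⁻¹' {w}) * μ (Z ⁻¹' {w.1}))).comp hW
  have hrt : ∫⁻ ω, r ω ∂μ ≠ ⊤ := ne_top_of_le_ne_top ENNReal.one_ne_top hr1
  have hri : Integrable (fun ω => (r ω).toReal) μ :=
    integrable_toReal_of_lintegral_ne_top hrm.aemeasurable hrt
  have hrle : ∫ ω, (r ω).toReal ∂μ ≤ 1 := by
    rw [integral_toReal hrm.aemeasurable (ae_lt_top hrm hrt)]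
    exact ENNReal.toReal_le_of_le_ofReal zero_le_one (by simpa using hr1)
  have key : ∀ᵐ ω ∂μ, info μ (joint Z (joint X Y)) ω + info μ Z ω ≤
      info μ (joint Z X) ω + info μ (joint Z Y) ω + ((r ω).toReal - 1) := by
    filter_upwards [ae_measure_fiber_pos hW, ae_measure_fiber_pos hZ, ae_measure_fiber_pos hZX,
      ae_measure_fiber_pos hZY] with ω h1 h2 h3 h4
    have hr : (r ω).toReal = μ.real (joint Z X ⁻¹' {joint Z X ω}) *
        μ.real (joint Z Y ⁻¹' {joint Z Y ω}) /
        (μ.real (joint Z (joint X Y) ⁻¹' {joint Z (joint X Y) ω}) * μ.real (Z ⁻¹' {Z ω})) := by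
      simp only [r, ENNReal.toReal_div, ENNReal.toReal_mul, measureReal_def]
    have hlog := Real.log_le_sub_one_of_pos (x := (r ω).toReal) (by rw [hr]; positivity)
    rw [hr, Real.log_div (by positivity) (by positivity), Real.log_mul h3.ne' h4.ne',
      Real.log_mul h1.ne' h2.ne', ← hr] at hlog
    simp only [info]
    linarith
  have hc : Integrable (fun ω => (r ω).toReal - 1) μ := hri.sub (integrable_const 1)
  have := integral_mono_ae (iW.add iZ) ((iZX.add iZY).add hc) key
  simp only [Pi.add_apply] at this
  rw [integral_add (f := fun ω => info μ (joint Z X) ω + info μ (joint Z Y) ω) (iZX.add iZY) hc,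
    integral_sub hri (integrable_const 1)] at this
  simp at this
  linarith

end Submodularity

/-! ### Submodularity and conditional independence up to equivalence of variables -/

section Relational

variable {Ω α β γ δ : Type*} [MeasurableSpace Ω] {μ : Measure Ω} [IsProbabilityMeasure μ]
  [Countable α] [MeasurableSpace α] [MeasurableSingletonClass α]
  [Countable β] [MeasurableSpace β] [MeasurableSingletonClass β]
  [Countable γ] [MeasurableSpace γ] [MeasurableSingletonClass γ]
  [Countable δ] [MeasurableSpace δ] [MeasurableSingletonClass δ]
  {F : Ω → α} {G : Ω → β} {K : Ω → γ} {L : Ω → δ}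

/-- Submodularity of entropy: `F` is equivalent to the pair `(G, K)`, and `L` is a common function
of `G` and of `K`. -/
theorem entropy_submodular (hf : HasFiniteEntropy μ F) (hF : Measurable F) (hG : Measurable G)
    (hK : Measurable K) (hL : Measurable L)
    (hFGK : ∀ ω ω', F ω = F ω' ↔ G ω = G ω' ∧ K ω = K ω')
    (hGL : ∀ ω ω', G ω = G ω' → L ω = L ω') (hKL : ∀ ω ω', K ω = K ω' → L ω = L ω') :
    entropy μ F + entropy μ L ≤ entropy μ G + entropy μ K := by
  have fG : HasFiniteEntropy μ G := hf.of_determined hF hG (by grind)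
  have fK : HasFiniteEntropy μ K := hf.of_determined hF hK (by grind)
  have mLG : Measurable (joint L G) := hL.prodMk hG
  have mLK : Measurable (joint L K) := hL.prodMk hK
  have mW : Measurable (joint L (joint G K)) := hL.prodMk (hG.prodMk hK)
  have e1 : entropy μ F = entropy μ (joint L (joint G K)) :=
    entropy_congr hf hF mW (by simp only [joint, Prod.mk.injEq]; grind)
  have e2 : entropy μ G = entropy μ (joint L G) :=
    entropy_congr fG hG mLG (by simp only [joint, Prod.mk.injEq]; grind)
  have e3 : entropy μ K = entropy μ (joint L K) :=
    entropy_congr fK hK mLK (by simp only [joint, Prod.mk.injEq]; grind)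
  rw [e1, e2, e3]
  exact entropy_submodular_joint hG hK hL
    (hf.of_determined hF mW (by simp only [joint, Prod.mk.injEq]; grind))

/-- The joint law factorizes as under conditional independence of `G` and `K` given `L`, where
`F` stands for the pair `(G, K)`. -/
def Factorizes (μ : Measure Ω) (F : Ω → α) (G : Ω → β) (K : Ω → γ) (L : Ω → δ) : Prop :=
  ∀ ω, μ.real (F ⁻¹' {F ω}) * μ.real (L ⁻¹' {L ω}) =
    μ.real (G ⁻¹' {G ω}) * μ.real (K ⁻¹' {K ω})

theorem Factorizes.info_eq (h : Factorizes μ F G K L) (hF : Measurable F) (hG : Measurable G)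
    (hK : Measurable K) (hL : Measurable L) :
    ∀ᵐ ω ∂μ, info μ F ω + info μ L ω = info μ G ω + info μ K ω := by
  filter_upwards [ae_measure_fiber_pos hF, ae_measure_fiber_pos hG, ae_measure_fiber_pos hK,
    ae_measure_fiber_pos hL] with ω h1 h2 h3 h4
  have := congrArg Real.log (h ω)
  rw [Real.log_mul h1.ne' h4.ne', Real.log_mul h2.ne' h3.ne'] at this
  simp only [info]
  linarith

/-- The factorization writes the information content of `F` almost surely as a combination of three
integrable functions. -/
theorem Factorizes.hasFiniteEntropy (h : Factorizes μ F G K L) (hF : Measurable F)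
    (hG : Measurable G) (hK : Measurable K) (hL : Measurable L) (fG : HasFiniteEntropy μ G)
    (fK : HasFiniteEntropy μ K) (fL : HasFiniteEntropy μ L) : HasFiniteEntropy μ F := by
  rw [← integrable_info_iff hG] at fG
  rw [← integrable_info_iff hK] at fK
  rw [← integrable_info_iff hL] at fL
  rw [← integrable_info_iff hF]
  refine ((fG.add fK).sub fL).congr ?_
  filter_upwards [h.info_eq hF hG hK hL] with ω hω
  simp only [Pi.sub_apply, Pi.add_apply]
  linarith

theorem Factorizes.entropy_eq (h : Factorizes μ F G K L) (hF : Measurable F)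
    (hG : Measurable G) (hK : Measurable K) (hL : Measurable L) (fF : HasFiniteEntropy μ F)
    (fG : HasFiniteEntropy μ G) (fK : HasFiniteEntropy μ K) (fL : HasFiniteEntropy μ L) :
    entropy μ F + entropy μ L = entropy μ G + entropy μ K := by
  rw [entropy_eq_integral_info hF fF, entropy_eq_integral_info hG fG,
    entropy_eq_integral_info hK fK, entropy_eq_integral_info hL fL,
    ← integral_add ((integrable_info_iff hF).2 fF) ((integrable_info_iff hL).2 fL),
    ← integral_add ((integrable_info_iff hG).2 fG) ((integrable_info_iff hK).2 fK)]
  exact integral_congr_ae (h.info_eq hF hG hK hL)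

end Relational

/-! ### Conditionally independent copies -/

section Copies

variable {Ω π U α : Type*} [MeasurableSpace Ω] {μ : Measure Ω} [IsProbabilityMeasure μ]
  [Countable π] [MeasurableSpace π] [MeasurableSingletonClass π]
  [Countable U] [MeasurableSpace U] [MeasurableSingletonClass U]
  [Countable α] [MeasurableSpace α] [MeasurableSingletonClass α]
  {P : Ω → π} {A : Ω → U} {Q : Ω → α}

open Classical in
/-- The conditional law of `A` given `P = p` (the law of `A` if `P = p` has probability zero). -/
noncomputable def condLaw (μ : Measure Ω) (P : Ω → π) (A : Ω → U) (p : π) : Measure U :=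
  if μ (P ⁻¹' {p}) = 0 then μ.map A else (ProbabilityTheory.cond μ (P ⁻¹' {p})).map A

/-- The default law on null atoms makes this hold for every `p`, as the infinite product requires;
`measure_mul_condLaw` shows that the choice is harmless. -/
theorem isProbabilityMeasure_condLaw (hA : Measurable A) (p : π) :
    IsProbabilityMeasure (condLaw μ P A p) := by
  unfold condLaw
  split_ifs with h
  · exact Measure.isProbabilityMeasure_map hA.aemeasurable
  · have := ProbabilityTheory.cond_isProbabilityMeasure h
    exact Measure.isProbabilityMeasure_map hA.aemeasurable

theorem measure_mul_condLaw (hP : Measurable P) (hA : Measurable A) (p : π) (a : U) :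
    μ.real (P ⁻¹' {p}) * (condLaw μ P A p).real {a} = μ.real (joint P A ⁻¹' {(p, a)}) := by
  have hj : joint P A ⁻¹' {(p, a)} = P ⁻¹' {p} ∩ A ⁻¹' {a} := by
    ext ω; simp [joint]
  rw [hj]
  unfold condLaw
  split_ifs with h
  · rw [measureReal_def, h, measureReal_def (s := P ⁻¹' {p} ∩ _),
      measure_mono_null Set.inter_subset_left h]
    simp
  · rw [map_measureReal_apply hA (measurableSet_singleton a),
      measureReal_def (s := A ⁻¹' {a}), ProbabilityTheory.cond_apply (hP (measurableSet_singleton p)),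
      ENNReal.toReal_mul, ENNReal.toReal_inv, ← mul_assoc, measureReal_def, mul_inv_cancel₀, one_mul]
    · rfl
    · exact (ENNReal.toReal_pos h (measure_ne_top _ _)).ne'

/-- The kernel producing infinitely many samples of `A` that are independent given `P`. -/
noncomputable def copiesKernel (μ : Measure Ω) (P : Ω → π) (A : Ω → U) (hP : Measurable P) :
    ProbabilityTheory.Kernel Ω (ℕ → U) :=
  (ProbabilityTheory.Kernel.ofFunOfCountable fun p =>
    Measure.infinitePi fun _ : ℕ => condLaw μ P A p).comap P hP

theorem copiesKernel_apply (hP : Measurable P) (ω : Ω) :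
    copiesKernel μ P A hP ω = Measure.infinitePi fun _ : ℕ => condLaw μ P A (P ω) := rfl

theorem isMarkovKernel_copiesKernel (hP : Measurable P) (hA : Measurable A) :
    ProbabilityTheory.IsMarkovKernel (copiesKernel μ P A hP) := by
  refine ⟨fun ω => ?_⟩
  have := fun p => isProbabilityMeasure_condLaw (μ := μ) (P := P) hA p
  rw [copiesKernel_apply]
  infer_instance

/-- The extension of `μ` by infinitely many copies of `A` that are independent given `P`. -/
noncomputable def withCopies (μ : Measure Ω) (P : Ω → π) (A : Ω → U) (hP : Measurable P) :
    Measure (Ω × (ℕ → U)) :=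
  μ.compProd (copiesKernel μ P A hP)

/-- The first `k` copies. -/
def firstCopies (Ω U : Type*) (k : ℕ) (w : Ω × (ℕ → U)) : Fin k → U := fun i => w.2 i

theorem measurable_firstCopies (k : ℕ) : Measurable (firstCopies Ω U k) := by
  unfold firstCopies
  fun_prop

theorem isProbabilityMeasure_withCopies (hP : Measurable P) (hA : Measurable A) :
    IsProbabilityMeasure (withCopies μ P A hP) := by
  have := isMarkovKernel_copiesKernel (μ := μ) hP hA
  unfold withCopies
  infer_instance

theorem withCopies_real_fst (hP : Measurable P) (hA : Measurable A) {s : Set Ω}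
    (hs : MeasurableSet s) :
    (withCopies μ P A hP).real (Prod.fst ⁻¹' s) = μ.real s := by
  have := isMarkovKernel_copiesKernel (μ := μ) hP hA
  have h : (withCopies μ P A hP).fst = μ := Measure.fst_compProd _ _
  rw [measureReal_def, measureReal_def, ← Measure.fst_apply hs, h]

theorem entropy_comp_fst (hP : Measurable P) (hA : Measurable A) (hQ : Measurable Q) :
    entropy (withCopies μ P A hP) (Q ∘ Prod.fst) = entropy μ Q := by
  refine tsum_congr fun q => ?_
  rw [Set.preimage_comp, withCopies_real_fst hP hA (hQ (measurableSet_singleton q))]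

theorem HasFiniteEntropy.comp_fst (hP : Measurable P) (hA : Measurable A) (hQ : Measurable Q)
    (hf : HasFiniteEntropy μ Q) :
    HasFiniteEntropy (withCopies μ P A hP) (Q ∘ Prod.fst) := by
  refine hf.congr fun q => ?_
  rw [Set.preimage_comp, withCopies_real_fst hP hA (hQ (measurableSet_singleton q))]

/-- Since `Q = q` forces `P = p`, the kernel is constant on that event, and the event for the copies
is a cylinder of the product measure. -/
theorem withCopies_real_joint_firstCopies (hP : Measurable P) (hA : Measurable A)
    (hQ : Measurable Q) {k : ℕ} (q : α) (p : π) (hqp : ∀ ω, Q ω = q → P ω = p) (z : Fin k → U) :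
    (withCopies μ P A hP).real (joint (Q ∘ Prod.fst) (firstCopies Ω U k) ⁻¹' {(q, z)}) =
      μ.real (Q ⁻¹' {q}) * ∏ i, (condLaw μ P A p).real {z i} := by
  have := isMarkovKernel_copiesKernel (μ := μ) hP hA
  have := fun p => isProbabilityMeasure_condLaw (μ := μ) (P := P) hA p
  let t : ℕ → Set U := fun n => if h : n < k then {z ⟨n, h⟩} else Set.univ
  have ht : ∀ n, MeasurableSet (t n) := fun n => (Set.to_countable (t n)).measurableSet
  have hset : joint (Q ∘ Prod.fst) (firstCopies Ω U k) ⁻¹' {(q, z)} =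
      (Q ⁻¹' {q}) ×ˢ Set.pi (Finset.range k : Set ℕ) t := by
    ext w
    simp only [joint, Set.mem_preimage, Set.mem_singleton_iff, Prod.mk.injEq, Set.mem_prod,
      Set.mem_pi, Finset.coe_range, Set.mem_Iio, Function.comp_apply, firstCopies, t, funext_iff]
    refine and_congr_right fun _ => ⟨fun h n hn => ?_, fun h i => ?_⟩
    · simpa [hn] using h ⟨n, hn⟩
    · simpa using h i i.2
  have hpi : MeasurableSet (Set.pi (Finset.range k : Set ℕ) t) :=
    MeasurableSet.pi (Set.to_countable _) fun n _ => ht n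
  have hmq : MeasurableSet (Q ⁻¹' {q}) := hQ (measurableSet_singleton q)
  have hval : ∀ ω ∈ Q ⁻¹' {q}, copiesKernel μ P A hP ω (Set.pi (Finset.range k : Set ℕ) t) =
      ∏ i : Fin k, condLaw μ P A p {z i} := by
    intro ω hω
    rw [copiesKernel_apply, hqp ω hω, Measure.infinitePi_pi _ fun n _ => ht n, Finset.prod_range]
    exact Finset.prod_congr rfl fun i _ => by simp [t]
  rw [measureReal_def, withCopies, hset, Measure.compProd_apply_prod hmq hpi,
    setLIntegral_congr_fun hmq hval, setLIntegral_const, ENNReal.toReal_mul, ENNReal.toReal_prod,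
    mul_comm]
  rfl

/-- The first `k` copies, followed by `A` itself. -/
def copiesSnoc (A : Ω → U) (k : ℕ) (w : Ω × (ℕ → U)) : Fin (k + 1) → U :=
  Fin.snoc (α := fun _ => U) (firstCopies Ω U k w) (A w.1)

theorem measurable_copiesSnoc (hA : Measurable A) (k : ℕ) : Measurable (copiesSnoc A k) := by
  refine measurable_pi_iff.2 fun i => ?_
  refine Fin.lastCases ?_ (fun j => ?_) i
  · simpa [copiesSnoc] using hA.fun_comp measurable_fst
  · simpa [copiesSnoc] using (measurable_pi_apply j).fun_comp (measurable_firstCopies k)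

theorem copiesSnoc_eq_iff (k : ℕ) (w : Ω × (ℕ → U)) (z : Fin (k + 1) → U) :
    copiesSnoc A k w = z ↔ A w.1 = z (Fin.last k) ∧ firstCopies Ω U k w = Fin.init z := by
  unfold copiesSnoc
  refine ⟨fun h => ?_, fun h => ?_⟩
  · rw [← h]; simp
  · rw [h.1, h.2]; simp

theorem copiesSnoc_eq_copiesSnoc_iff (k : ℕ) (w w' : Ω × (ℕ → U)) :
    copiesSnoc A k w = copiesSnoc A k w' ↔
      A w.1 = A w'.1 ∧ firstCopies Ω U k w = firstCopies Ω U k w' := by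
  rw [copiesSnoc_eq_iff]
  simp [copiesSnoc]

/-- Conditionally on `P`, the original `A` has the law of a copy and is independent of the copies,
so it can play the part of the copy numbered `k + 1`. This exchange drives the telescoping. -/
theorem map_joint_firstCopies_succ (hP : Measurable P) (hA : Measurable A) (k : ℕ) :
    (withCopies μ P A hP).map (joint (P ∘ Prod.fst) (firstCopies Ω U (k + 1))) =
      (withCopies μ P A hP).map (joint (P ∘ Prod.fst) (copiesSnoc A k)) := by
  have := isProbabilityMeasure_withCopies (μ := μ) hP hA
  have hPf : Measurable (P ∘ Prod.fst : Ω × (ℕ → U) → π) := hP.comp measurable_fst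
  refine Measure.ext_of_singleton fun ⟨p, z⟩ => ?_
  rw [Measure.map_apply (measurable_joint hPf (measurable_firstCopies _))
      (measurableSet_singleton _),
    Measure.map_apply (measurable_joint hPf (measurable_copiesSnoc hA k))
      (measurableSet_singleton _),
    ← measureReal_eq_measureReal_iff]
  have hset : joint (P ∘ Prod.fst) (copiesSnoc A k) ⁻¹' {(p, z)} =
      joint (joint P A ∘ Prod.fst) (firstCopies Ω U k) ⁻¹'
        {((p, z (Fin.last k)), Fin.init z)} := by
    ext w
    simp only [joint, Set.mem_preimage, Set.mem_singleton_iff, Prod.mk.injEq, Function.comp_apply,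
      copiesSnoc_eq_iff, and_assoc]
  rw [hset, withCopies_real_joint_firstCopies hP hA hP p p (fun _ h => h),
    withCopies_real_joint_firstCopies hP hA (measurable_joint hP hA)
      (p, z (Fin.last k)) p fun ω h => (Prod.ext_iff.1 h).1,
    ← measure_mul_condLaw hP hA, Fin.prod_univ_castSucc, mul_assoc]
  congr 1
  rw [mul_comm]
  rfl

/-- The copies depend on the original space only through `P`; hence they are independent, given `P`,
of any `Q` that determines `P`. -/
theorem factorizes_withCopies (hP : Measurable P) (hA : Measurable A) (hQ : Measurable Q)
    (hQP : ∀ ω ω', Q ω = Q ω' → P ω = P ω') (k : ℕ) :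
    Factorizes (withCopies μ P A hP) (joint (Q ∘ Prod.fst) (firstCopies Ω U k))
      (joint (P ∘ Prod.fst) (firstCopies Ω U k)) (Q ∘ Prod.fst) (P ∘ Prod.fst) := by
  intro w
  have h1 := withCopies_real_joint_firstCopies (μ := μ) hP hA hQ (Q w.1) (P w.1)
    (fun ω h => hQP _ _ h) (firstCopies Ω U k w)
  have h2 := withCopies_real_joint_firstCopies (μ := μ) hP hA hP (P w.1) (P w.1)
    (fun ω h => h) (firstCopies Ω U k w)
  have h3 := withCopies_real_fst (μ := μ) hP hA (hQ (measurableSet_singleton (Q w.1)))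
  have h4 := withCopies_real_fst (μ := μ) hP hA (hP (measurableSet_singleton (P w.1)))
  have e1 : joint (Q ∘ Prod.fst) (firstCopies Ω U k) w = (Q w.1, firstCopies Ω U k w) := rfl
  have e2 : joint (P ∘ Prod.fst) (firstCopies Ω U k) w = (P w.1, firstCopies Ω U k w) := rfl
  rw [e1, e2, h1, h2, Set.preimage_comp, Set.preimage_comp, Function.comp_apply,
    Function.comp_apply, h3, h4]
  ring

end Copies

/-! ### Invariance of entropy under equality of laws -/

section Law

variable {Ω α : Type*} [MeasurableSpace Ω] {μ : Measure Ω}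
  [MeasurableSpace α] [MeasurableSingletonClass α] {F G : Ω → α}

theorem real_preimage_eq_of_map_eq (hF : Measurable F) (hG : Measurable G)
    (h : μ.map F = μ.map G) (x : α) : μ.real (F ⁻¹' {x}) = μ.real (G ⁻¹' {x}) := by
  rw [← map_measureReal_apply hF (measurableSet_singleton x), h,
    map_measureReal_apply hG (measurableSet_singleton x)]

theorem entropy_eq_of_map_eq (hF : Measurable F) (hG : Measurable G)
    (h : μ.map F = μ.map G) : entropy μ F = entropy μ G :=
  tsum_congr fun x => by rw [real_preimage_eq_of_map_eq hF hG h x]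

theorem HasFiniteEntropy.of_map_eq (hF : Measurable F) (hG : Measurable G)
    (h : μ.map F = μ.map G) (hf : HasFiniteEntropy μ G) : HasFiniteEntropy μ F :=
  hf.congr fun x => by rw [real_preimage_eq_of_map_eq hF hG h x]

end Law

/-! ### Shannon-type inequalities with an auxiliary variable -/

section CopyInequalities

variable {Ω S T U V W : Type*} [MeasurableSpace Ω] {μ : Measure Ω} [IsProbabilityMeasure μ]
  [Countable S] [MeasurableSpace S] [MeasurableSingletonClass S]
  [Countable T] [MeasurableSpace T] [MeasurableSingletonClass T]
  [Countable U] [MeasurableSpace U] [MeasurableSingletonClass U]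
  [Countable V] [MeasurableSpace V] [MeasurableSingletonClass V]
  [Countable W] [MeasurableSpace W] [MeasurableSingletonClass W]
  {X : Ω → S} {Y : Ω → T} {A : Ω → U} {B : Ω → V} {Z : Ω → W}

/-- An entropy inequality for a variable `Z` that is independent of `(A, B)` given `(X, Y)`. -/
theorem mutualInfo_le_of_condIndep (hX : Measurable X) (hY : Measurable Y) (hA : Measurable A)
    (hB : Measurable B) (hZ : Measurable Z)
    (hf : HasFiniteEntropy μ (joint (joint X (joint Y (joint A B))) Z))
    (hAB : entropy μ (joint (joint X (joint Y (joint A B))) Z) + entropy μ (joint X Y) =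
      entropy μ (joint (joint X Y) Z) + entropy μ (joint X (joint Y (joint A B))))
    (hA' : entropy μ (joint (joint X (joint Y A)) Z) + entropy μ (joint X Y) =
      entropy μ (joint (joint X Y) Z) + entropy μ (joint X (joint Y A)))
    (hB' : entropy μ (joint (joint X (joint Y B)) Z) + entropy μ (joint X Y) =
      entropy μ (joint (joint X Y) Z) + entropy μ (joint X (joint Y B))) :
    mutualInfo μ X Y ≤ condMutualInfo μ X Y A + condMutualInfo μ X Y B + mutualInfo μ A B +
      (condMutualInfo μ X Y Z - condMutualInfo μ X Y (joint Z A)) +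
      condMutualInfo μ Z X Y + condMutualInfo μ Z Y X := by
  have hm : Measurable (joint (joint X (joint Y (joint A B))) Z) := by unfold joint; fun_prop
  have c1 : entropy μ (joint Y X) = entropy μ (joint X Y) :=
    entropy_congr (hf.of_determined hm (by unfold joint; fun_prop) (by simp +contextual [joint]))
      (by unfold joint; fun_prop) (by unfold joint; fun_prop) (by simp [joint]; grind)
  have c2 : entropy μ (joint Z X) = entropy μ (joint X Z) :=
    entropy_congr (hf.of_determined hm (by unfold joint; fun_prop) (by simp +contextual [joint]))
      (by unfold joint; fun_prop) (by unfold joint; fun_prop) (by simp [joint]; grind)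
  have c3 : entropy μ (joint Z Y) = entropy μ (joint Y Z) :=
    entropy_congr (hf.of_determined hm (by unfold joint; fun_prop) (by simp +contextual [joint]))
      (by unfold joint; fun_prop) (by unfold joint; fun_prop) (by simp [joint]; grind)
  have c4 : entropy μ (joint Z (joint X Y)) = entropy μ (joint X (joint Y Z)) :=
    entropy_congr (hf.of_determined hm (by unfold joint; fun_prop) (by simp +contextual [joint]))
      (by unfold joint; fun_prop) (by unfold joint; fun_prop) (by simp [joint]; grind)
  have c5 : entropy μ (joint Z (joint Y X)) = entropy μ (joint X (joint Y Z)) :=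
    entropy_congr (hf.of_determined hm (by unfold joint; fun_prop) (by simp +contextual [joint]))
      (by unfold joint; fun_prop) (by unfold joint; fun_prop) (by simp [joint]; grind)
  have c6 : entropy μ (joint (joint X Y) Z) = entropy μ (joint X (joint Y Z)) :=
    entropy_congr (hf.of_determined hm (by unfold joint; fun_prop) (by simp +contextual [joint]))
      (by unfold joint; fun_prop) (by unfold joint; fun_prop) (by simp [joint]; grind)
  have c7 : entropy μ (joint (joint X (joint Y A)) Z) = entropy μ (joint X (joint Y (joint Z A))) :=
    entropy_congr (hf.of_determined hm (by unfold joint; fun_prop) (by simp +contextual [joint]))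
      (by unfold joint; fun_prop) (by unfold joint; fun_prop) (by simp [joint]; grind)
  have c8 : entropy μ (joint (joint X (joint Y B)) Z) = entropy μ (joint X (joint Y (joint Z B))) :=
    entropy_congr (hf.of_determined hm (by unfold joint; fun_prop) (by simp +contextual [joint]))
      (by unfold joint; fun_prop) (by unfold joint; fun_prop) (by simp [joint]; grind)
  -- Modulo the three independence identities, right side minus left side is exactly `I(A:Z|X) +
  -- I(A:Z|Y) + I(B:Z|X) + I(B:Z|Y) + I(X:Y|Z,B) + I(A:B|Z) + I(X,Y:Z|A,B)`; `s1` to `s7` are the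
  -- nonnegativity of these terms, in this order.
  have s1 := entropy_submodular (μ := μ) (F := joint X (joint Z A)) (G := joint X A)
    (K := joint X Z) (L := X)
    (hf.of_determined hm (by unfold joint; fun_prop) (by simp +contextual [joint]))
    (by unfold joint; fun_prop) (by unfold joint; fun_prop) (by unfold joint; fun_prop) hX
    (by simp [joint]; grind) (by simp +contextual [joint]) (by simp +contextual [joint])
  have s2 := entropy_submodular (μ := μ) (F := joint Y (joint Z A)) (G := joint Y A)
    (K := joint Y Z) (L := Y)
    (hf.of_determined hm (by unfold joint; fun_prop) (by simp +contextual [joint]))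
    (by unfold joint; fun_prop) (by unfold joint; fun_prop) (by unfold joint; fun_prop) hY
    (by simp [joint]; grind) (by simp +contextual [joint]) (by simp +contextual [joint])
  have s3 := entropy_submodular (μ := μ) (F := joint X (joint Z B)) (G := joint X B)
    (K := joint X Z) (L := X)
    (hf.of_determined hm (by unfold joint; fun_prop) (by simp +contextual [joint]))
    (by unfold joint; fun_prop) (by unfold joint; fun_prop) (by unfold joint; fun_prop) hX
    (by simp [joint]; grind) (by simp +contextual [joint]) (by simp +contextual [joint])
  have s4 := entropy_submodular (μ := μ) (F := joint Y (joint Z B)) (G := joint Y B)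
    (K := joint Y Z) (L := Y)
    (hf.of_determined hm (by unfold joint; fun_prop) (by simp +contextual [joint]))
    (by unfold joint; fun_prop) (by unfold joint; fun_prop) (by unfold joint; fun_prop) hY
    (by simp [joint]; grind) (by simp +contextual [joint]) (by simp +contextual [joint])
  have s5 := entropy_submodular (μ := μ) (F := joint X (joint Y (joint Z B)))
    (G := joint X (joint Z B)) (K := joint Y (joint Z B)) (L := joint Z B)
    (hf.of_determined hm (by unfold joint; fun_prop) (by simp +contextual [joint]))
    (by unfold joint; fun_prop) (by unfold joint; fun_prop) (by unfold joint; fun_prop)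
    (by unfold joint; fun_prop)
    (by simp [joint]; grind) (by simp +contextual [joint]) (by simp +contextual [joint])
  have s6 := entropy_submodular (μ := μ) (F := joint Z (joint A B))
    (G := joint Z A) (K := joint Z B) (L := Z)
    (hf.of_determined hm (by unfold joint; fun_prop) (by simp +contextual [joint]))
    (by unfold joint; fun_prop) (by unfold joint; fun_prop) (by unfold joint; fun_prop) hZ
    (by simp [joint]; grind) (by simp +contextual [joint]) (by simp +contextual [joint])
  have s7 := entropy_submodular (μ := μ) (F := joint (joint X (joint Y (joint A B))) Z)
    (G := joint X (joint Y (joint A B))) (K := joint Z (joint A B)) (L := joint A B) hf hm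
    (by unfold joint; fun_prop) (by unfold joint; fun_prop) (by unfold joint; fun_prop)
    (by simp [joint]; grind) (by simp +contextual [joint]) (by simp +contextual [joint])
  unfold mutualInfo condMutualInfo condEntropy
  linarith

/-- If `A` and `Z` are independent given `(X, Y)`, then conditional mutual information with `X`
given `Y` is subadditive over the pair `(Z, A)`. -/
theorem condMutualInfo_pair_le (hX : Measurable X) (hY : Measurable Y) (hA : Measurable A)
    (hZ : Measurable Z) (hf : HasFiniteEntropy μ (joint (joint X (joint Y A)) Z))
    (h : entropy μ (joint (joint X (joint Y A)) Z) + entropy μ (joint X Y) =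
      entropy μ (joint (joint X Y) Z) + entropy μ (joint X (joint Y A))) :
    condMutualInfo μ (joint Z A) X Y ≤ condMutualInfo μ Z X Y + condMutualInfo μ A X Y ∧
    condMutualInfo μ (joint Z A) Y X ≤ condMutualInfo μ Z Y X + condMutualInfo μ A Y X := by
  have hm : Measurable (joint (joint X (joint Y A)) Z) := by unfold joint; fun_prop
  have c1 : entropy μ (joint Y X) = entropy μ (joint X Y) :=
    entropy_congr (hf.of_determined hm (by unfold joint; fun_prop) (by simp +contextual [joint]))
      (by unfold joint; fun_prop) (by unfold joint; fun_prop) (by simp [joint]; grind)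
  have c2 : entropy μ (joint Z (joint X Y)) = entropy μ (joint (joint X Y) Z) :=
    entropy_congr (hf.of_determined hm (by unfold joint; fun_prop) (by simp +contextual [joint]))
      (by unfold joint; fun_prop) (by unfold joint; fun_prop) (by simp [joint]; grind)
  have c3 : entropy μ (joint Z (joint Y X)) = entropy μ (joint (joint X Y) Z) :=
    entropy_congr (hf.of_determined hm (by unfold joint; fun_prop) (by simp +contextual [joint]))
      (by unfold joint; fun_prop) (by unfold joint; fun_prop) (by simp [joint]; grind)
  have c4 : entropy μ (joint A (joint X Y)) = entropy μ (joint X (joint Y A)) :=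
    entropy_congr (hf.of_determined hm (by unfold joint; fun_prop) (by simp +contextual [joint]))
      (by unfold joint; fun_prop) (by unfold joint; fun_prop) (by simp [joint]; grind)
  have c5 : entropy μ (joint A (joint Y X)) = entropy μ (joint X (joint Y A)) :=
    entropy_congr (hf.of_determined hm (by unfold joint; fun_prop) (by simp +contextual [joint]))
      (by unfold joint; fun_prop) (by unfold joint; fun_prop) (by simp [joint]; grind)
  have c6 : entropy μ (joint (joint Z A) (joint X Y)) = entropy μ (joint (joint X (joint Y A)) Z) :=
    entropy_congr (hf.of_determined hm (by unfold joint; fun_prop) (by simp +contextual [joint]))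
      (by unfold joint; fun_prop) (by unfold joint; fun_prop) (by simp [joint]; grind)
  have c7 : entropy μ (joint (joint Z A) (joint Y X)) = entropy μ (joint (joint X (joint Y A)) Z) :=
    entropy_congr (hf.of_determined hm (by unfold joint; fun_prop) (by simp +contextual [joint]))
      (by unfold joint; fun_prop) (by unfold joint; fun_prop) (by simp [joint]; grind)
  -- `H(Z,A|Y)` is subadditive, while `H(Z,A|X,Y)` is additive by `h`; `s2` does the same with `X`
  -- and `Y` exchanged.
  have s1 := entropy_submodular (μ := μ) (F := joint (joint Z A) Y) (G := joint Z Y)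
    (K := joint A Y) (L := Y)
    (hf.of_determined hm (by unfold joint; fun_prop) (by simp +contextual [joint]))
    (by unfold joint; fun_prop) (by unfold joint; fun_prop) (by unfold joint; fun_prop) hY
    (by simp [joint]; grind) (by simp +contextual [joint]) (by simp +contextual [joint])
  have s2 := entropy_submodular (μ := μ) (F := joint (joint Z A) X) (G := joint Z X)
    (K := joint A X) (L := X)
    (hf.of_determined hm (by unfold joint; fun_prop) (by simp +contextual [joint]))
    (by unfold joint; fun_prop) (by unfold joint; fun_prop) (by unfold joint; fun_prop) hX
    (by simp [joint]; grind) (by simp +contextual [joint]) (by simp +contextual [joint])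
  unfold condMutualInfo condEntropy
  constructor <;> linarith

theorem condMutualInfo_nonneg (hX : Measurable X) (hY : Measurable Y) (hZ : Measurable Z)
    (hf : HasFiniteEntropy μ (joint X (joint Y Z))) : 0 ≤ condMutualInfo μ X Y Z := by
  have hm : Measurable (joint X (joint Y Z)) := by unfold joint; fun_prop
  have s := entropy_submodular (μ := μ) (F := joint X (joint Y Z)) (G := joint X Z)
    (K := joint Y Z) (L := Z) hf hm
    (by unfold joint; fun_prop) (by unfold joint; fun_prop) hZ
    (by simp [joint]; grind) (by simp +contextual [joint]) (by simp +contextual [joint])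
  unfold condMutualInfo condEntropy
  linarith

theorem mutualInfo_nonneg (hX : Measurable X) (hY : Measurable Y)
    (hf : HasFiniteEntropy μ (joint X Y)) : 0 ≤ mutualInfo μ X Y := by
  have hm : Measurable (joint X Y) := measurable_joint hX hY
  have s := entropy_submodular (μ := μ) (F := joint X Y) (G := X)
    (K := Y) (L := fun _ => ()) hf hm hX hY measurable_const
    (by simp [joint]) (by simp) (by simp)
  have h0 : entropy μ (fun _ : Ω => ()) = 0 := by simp [entropy]
  unfold mutualInfo condEntropy
  linarith

end CopyInequalities

/-! ### Iterating over the copies -/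

section Iteration

variable {Ω S T U V β γ : Type*} [MeasurableSpace Ω] {μ : Measure Ω} [IsProbabilityMeasure μ]
  [Countable S] [MeasurableSpace S] [MeasurableSingletonClass S]
  [Countable T] [MeasurableSpace T] [MeasurableSingletonClass T]
  [Countable U] [MeasurableSpace U] [MeasurableSingletonClass U]
  [Countable V] [MeasurableSpace V] [MeasurableSingletonClass V]
  [Countable β] [MeasurableSpace β] [MeasurableSingletonClass β]
  [Countable γ] [MeasurableSpace γ] [MeasurableSingletonClass γ]
  {P : Ω → S} {A : Ω → U} {Q : Ω → T}

/-- Induction on `k`: up to law the next copy may be replaced by `A`, and `(P, A)` with the first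
`k` copies factorizes over `P` into pieces already known to have finite entropy. -/
theorem hasFiniteEntropy_joint_firstCopies (hP : Measurable P) (hA : Measurable A)
    (hf : HasFiniteEntropy μ (joint P A)) (k : ℕ) :
    HasFiniteEntropy (withCopies μ P A hP) (joint (P ∘ Prod.fst) (firstCopies Ω U k)) := by
  have := isProbabilityMeasure_withCopies (μ := μ) hP hA
  have fP : HasFiniteEntropy μ P :=
    hf.of_determined (measurable_joint hP hA) hP (by simp +contextual [joint])
  have hPf : Measurable (P ∘ Prod.fst : Ω × (ℕ → U) → S) := hP.comp measurable_fst
  induction k with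
  | zero =>
    refine (fP.comp_fst hP hA hP).of_determined hPf
      (measurable_joint hPf (measurable_firstCopies _)) fun w w' h => ?_
    exact Prod.ext h (Subsingleton.elim _ _)
  | succ k ih =>
    have hPA := measurable_joint hP hA
    have hPAf : Measurable (joint P A ∘ Prod.fst : Ω × (ℕ → U) → S × U) := hPA.comp measurable_fst
    have fj : HasFiniteEntropy (withCopies μ P A hP)
        (joint (joint P A ∘ Prod.fst) (firstCopies Ω U k)) :=
      (factorizes_withCopies hP hA hPA (by simp +contextual [joint]) k).hasFiniteEntropy
        (measurable_joint hPAf (measurable_firstCopies _))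
        (measurable_joint hPf (measurable_firstCopies _)) hPAf hPf ih (hf.comp_fst hP hA hPA)
        (fP.comp_fst hP hA hP)
    refine HasFiniteEntropy.of_map_eq (measurable_joint hPf (measurable_firstCopies _))
      (measurable_joint hPf (measurable_copiesSnoc hA k)) (map_joint_firstCopies_succ hP hA k) ?_
    refine fj.of_determined (measurable_joint hPAf (measurable_firstCopies _))
      (measurable_joint hPf (measurable_copiesSnoc hA k)) fun w w' h => ?_
    simp only [joint, Prod.mk.injEq, Function.comp_apply, copiesSnoc_eq_copiesSnoc_iff] at h ⊢
    tauto

theorem hasFiniteEntropy_joint_firstCopies_of_determines (hP : Measurable P) (hA : Measurable A)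
    (hQ : Measurable Q) (hf : HasFiniteEntropy μ Q)
    (hQP : ∀ ω ω', Q ω = Q ω' → joint P A ω = joint P A ω') (k : ℕ) :
    HasFiniteEntropy (withCopies μ P A hP) (joint (Q ∘ Prod.fst) (firstCopies Ω U k)) := by
  have := isProbabilityMeasure_withCopies (μ := μ) hP hA
  have hQP' : ∀ ω ω', Q ω = Q ω' → P ω = P ω' := fun ω ω' h => (Prod.ext_iff.1 (hQP ω ω' h)).1
  have hQf : Measurable (Q ∘ Prod.fst : Ω × (ℕ → U) → T) := hQ.comp measurable_fst
  have hPf : Measurable (P ∘ Prod.fst : Ω × (ℕ → U) → S) := hP.comp measurable_fst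
  exact (factorizes_withCopies hP hA hQ hQP' k).hasFiniteEntropy
    (measurable_joint hQf (measurable_firstCopies _))
    (measurable_joint hPf (measurable_firstCopies _)) hQf hPf
    (hasFiniteEntropy_joint_firstCopies hP hA (hf.of_determined hQ (measurable_joint hP hA) hQP) k)
    (hf.comp_fst hP hA hQ) ((hf.of_determined hQ hP hQP').comp_fst hP hA hP)

theorem entropy_joint_firstCopies_add (hP : Measurable P) (hA : Measurable A)
    (hQ : Measurable Q) (hf : HasFiniteEntropy μ Q)
    (hQP : ∀ ω ω', Q ω = Q ω' → P ω = P ω') (hPA : HasFiniteEntropy μ (joint P A)) (k : ℕ) :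
    entropy (withCopies μ P A hP) (joint (Q ∘ Prod.fst) (firstCopies Ω U k)) +
        entropy (withCopies μ P A hP) (P ∘ Prod.fst) =
      entropy (withCopies μ P A hP) (joint (P ∘ Prod.fst) (firstCopies Ω U k)) +
        entropy (withCopies μ P A hP) (Q ∘ Prod.fst) := by
  have := isProbabilityMeasure_withCopies (μ := μ) hP hA
  have hQf : Measurable (Q ∘ Prod.fst : Ω × (ℕ → U) → T) := hQ.comp measurable_fst
  have hPf : Measurable (P ∘ Prod.fst : Ω × (ℕ → U) → S) := hP.comp measurable_fst
  have f1 := hasFiniteEntropy_joint_firstCopies hP hA hPA k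
  have f2 := hf.comp_fst hP hA hQ
  have f3 := (hf.of_determined hQ hP hQP).comp_fst hP hA hP
  have hfac := factorizes_withCopies (μ := μ) hP hA hQ hQP k
  have m1 := measurable_joint hQf (measurable_firstCopies (Ω := Ω) (U := U) k)
  have m2 := measurable_joint hPf (measurable_firstCopies (Ω := Ω) (U := U) k)
  exact hfac.entropy_eq m1 m2 hQf hPf (hfac.hasFiniteEntropy m1 m2 hQf hPf f1 f2 f3) f1 f2 f3

/-- Functions of `P` and the first `k + 1` copies have the same entropy as the same functions of
`P`, the first `k` copies, and `A`. -/
theorem entropy_firstCopies_succ (hP : Measurable P) (hA : Measurable A)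
    (hf : HasFiniteEntropy μ (joint P A)) (k : ℕ) (g : S × (Fin (k + 1) → U) → β)
    {G : Ω × (ℕ → U) → γ} (hG : Measurable G)
    (hg : ∀ w w', g (joint (P ∘ Prod.fst) (copiesSnoc A k) w) =
      g (joint (P ∘ Prod.fst) (copiesSnoc A k) w') ↔ G w = G w') :
    entropy (withCopies μ P A hP) (g ∘ joint (P ∘ Prod.fst) (firstCopies Ω U (k + 1))) =
      entropy (withCopies μ P A hP) G := by
  have := isProbabilityMeasure_withCopies (μ := μ) hP hA
  have hPf : Measurable (P ∘ Prod.fst : Ω × (ℕ → U) → S) := hP.comp measurable_fst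
  have hgm : Measurable g := measurable_of_countable g
  have hmap := map_joint_firstCopies_succ (μ := μ) hP hA k
  have m1 := measurable_joint hPf (measurable_firstCopies (Ω := Ω) (U := U) (k + 1))
  have m2 := measurable_joint hPf (measurable_copiesSnoc hA k)
  have hfin := (hasFiniteEntropy_joint_firstCopies (μ := μ) hP hA hf (k + 1)).of_map_eq m2 m1
    hmap.symm
  rw [entropy_eq_of_map_eq (hgm.comp m1) (hgm.comp m2)
    (by rw [← Measure.map_map hgm m1, ← Measure.map_map hgm m2, hmap])]
  exact entropy_congr (hfin.of_determined m2 (hgm.comp m2) fun w w' h => congrArg g h)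
    (hgm.comp m2) hG hg

theorem mutualInfo_comp_fst {X : Ω → β} {Y : Ω → γ} (hP : Measurable P) (hA : Measurable A)
    (hX : Measurable X) (hY : Measurable Y) :
    mutualInfo (withCopies μ P A hP) (X ∘ Prod.fst) (Y ∘ Prod.fst) = mutualInfo μ X Y :=
  congrArg₂ _ (entropy_comp_fst hP hA hX) (congrArg₂ _
    (entropy_comp_fst hP hA (measurable_joint hX hY)) (entropy_comp_fst hP hA hY))

theorem condEntropy_comp_fst {X : Ω → β} {Y : Ω → γ} (hP : Measurable P) (hA : Measurable A)
    (hX : Measurable X) (hY : Measurable Y) :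
    condEntropy (withCopies μ P A hP) (X ∘ Prod.fst) (Y ∘ Prod.fst) = condEntropy μ X Y :=
  congrArg₂ _ (entropy_comp_fst hP hA (measurable_joint hX hY)) (entropy_comp_fst hP hA hY)

theorem condMutualInfo_comp_fst {X : Ω → β} {Y : Ω → γ} {Z : Ω → V} (hP : Measurable P)
    (hA : Measurable A) (hX : Measurable X) (hY : Measurable Y) (hZ : Measurable Z) :
    condMutualInfo (withCopies μ P A hP) (X ∘ Prod.fst) (Y ∘ Prod.fst) (Z ∘ Prod.fst) =
      condMutualInfo μ X Y Z := by
  have h1 := condEntropy_comp_fst (μ := μ) hP hA hX hZ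
  have h2 := condEntropy_comp_fst (μ := μ) hP hA hX (measurable_joint hY hZ)
  change condEntropy _ (X ∘ Prod.fst) (Z ∘ Prod.fst) -
    condEntropy _ (X ∘ Prod.fst) (joint Y Z ∘ Prod.fst) = _
  rw [h1, h2, condMutualInfo]

/-- Matúš's sequence of non-Shannon-type information inequalities. -/
theorem nsmul_mutualInfo_le {X : Ω → S} {Y : Ω → T} {A : Ω → U} {B : Ω → V}
    (hX : Measurable X) (hY : Measurable Y) (hA : Measurable A) (hB : Measurable B)
    (hf : HasFiniteEntropy μ (joint X (joint Y (joint A B)))) (n : ℕ) :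
    n * mutualInfo μ X Y ≤
      n * (condMutualInfo μ X Y A + condMutualInfo μ X Y B + mutualInfo μ A B) +
        mutualInfo μ X Y +
        n * (n - 1) / 2 * (condMutualInfo μ A X Y + condMutualInfo μ A Y X) := by
  have hP : Measurable (joint X Y) := measurable_joint hX hY
  have hE : Measurable (joint X (joint Y (joint A B))) := by unfold joint; fun_prop
  have hPA : HasFiniteEntropy μ (joint (joint X Y) A) :=
    hf.of_determined hE (by unfold joint; fun_prop) (by simp +contextual [joint])
  have hXYA : HasFiniteEntropy μ (joint X (joint Y A)) :=
    hf.of_determined hE (by unfold joint; fun_prop) (by simp +contextual [joint])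
  have hXYB : HasFiniteEntropy μ (joint X (joint Y B)) :=
    hf.of_determined hE (by unfold joint; fun_prop) (by simp +contextual [joint])
  have hν := isProbabilityMeasure_withCopies (μ := μ) hP hA
  set ν := withCopies μ (joint X Y) A hP with hνdef
  let X' : Ω × (ℕ → U) → S := X ∘ Prod.fst
  let Y' : Ω × (ℕ → U) → T := Y ∘ Prod.fst
  let A' : Ω × (ℕ → U) → U := A ∘ Prod.fst
  let B' : Ω × (ℕ → U) → V := B ∘ Prod.fst
  let Z : (k : ℕ) → Ω × (ℕ → U) → (Fin k → U) := firstCopies Ω U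
  have mX : Measurable X' := hX.comp measurable_fst
  have mY : Measurable Y' := hY.comp measurable_fst
  have mA : Measurable A' := hA.comp measurable_fst
  have mB : Measurable B' := hB.comp measurable_fst
  have mZ : ∀ k, Measurable (Z k) := measurable_firstCopies
  have mE : ∀ k, Measurable (joint (joint X' (joint Y' (joint A' B'))) (Z k)) := fun k => by
    have := mZ k
    unfold joint; fun_prop
  have fE : ∀ k, HasFiniteEntropy ν (joint (joint X' (joint Y' (joint A' B'))) (Z k)) := fun k =>
    hasFiniteEntropy_joint_firstCopies_of_determines hP hA hE hf (by simp +contextual [joint]) k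
  have fEA : ∀ k, HasFiniteEntropy ν (joint (joint X' (joint Y' A')) (Z k)) := fun k =>
    (fE k).of_determined (mE k) (by have := mZ k; unfold joint; fun_prop)
      (by simp +contextual [joint])
  have e1 : ∀ k, entropy ν (joint (joint X' (joint Y' (joint A' B'))) (Z k)) +
      entropy ν (joint X' Y') = entropy ν (joint (joint X' Y') (Z k)) +
        entropy ν (joint X' (joint Y' (joint A' B'))) := fun k =>
    entropy_joint_firstCopies_add hP hA hE hf (by simp +contextual [joint]) hPA k
  have e2 : ∀ k, entropy ν (joint (joint X' (joint Y' A')) (Z k)) +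
      entropy ν (joint X' Y') = entropy ν (joint (joint X' Y') (Z k)) +
        entropy ν (joint X' (joint Y' A')) := fun k =>
    entropy_joint_firstCopies_add hP hA (by unfold joint; fun_prop) hXYA
      (by simp +contextual [joint]) hPA k
  have e3 : ∀ k, entropy ν (joint (joint X' (joint Y' B')) (Z k)) +
      entropy ν (joint X' Y') = entropy ν (joint (joint X' Y') (Z k)) +
        entropy ν (joint X' (joint Y' B')) := fun k =>
    entropy_joint_firstCopies_add hP hA (by unfold joint; fun_prop) hXYB
      (by simp +contextual [joint]) hPA k
  have hmain : ∀ k, mutualInfo ν X' Y' ≤ condMutualInfo ν X' Y' A' + condMutualInfo ν X' Y' B' +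
      mutualInfo ν A' B' +
      (condMutualInfo ν X' Y' (Z k) - condMutualInfo ν X' Y' (joint (Z k) A')) +
      condMutualInfo ν (Z k) X' Y' + condMutualInfo ν (Z k) Y' X' := fun k =>
    mutualInfo_le_of_condIndep mX mY mA mB (mZ k) (fE k) (e1 k) (e2 k) (e3 k)
  -- The exchange of `A` for the next copy turns the bracket in `hmain` into a difference of
  -- consecutive terms.
  have l1 : ∀ k, condMutualInfo ν X' Y' (Z (k + 1)) = condMutualInfo ν X' Y' (joint (Z k) A') := by
    intro k
    have := mZ k
    have a1 : entropy ν (joint X' (Z (k + 1))) = entropy ν (joint X' (joint (Z k) A')) :=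
      entropy_firstCopies_succ hP hA hPA k (fun q => (q.1.1, q.2)) (by unfold joint; fun_prop)
        (by simp [joint, copiesSnoc_eq_copiesSnoc_iff, X', Z, A']; tauto)
    have a2 : entropy ν (Z (k + 1)) = entropy ν (joint (Z k) A') :=
      entropy_firstCopies_succ hP hA hPA k (fun q => q.2) (by unfold joint; fun_prop)
        (by simp [joint, copiesSnoc_eq_copiesSnoc_iff, Z, A']; tauto)
    have a3 : entropy ν (joint X' (joint Y' (Z (k + 1)))) =
        entropy ν (joint X' (joint Y' (joint (Z k) A'))) :=
      entropy_firstCopies_succ hP hA hPA k (fun q => (q.1.1, q.1.2, q.2))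
        (by unfold joint; fun_prop)
        (by simp [joint, copiesSnoc_eq_copiesSnoc_iff, X', Y', Z, A']; tauto)
    have a4 : entropy ν (joint Y' (Z (k + 1))) = entropy ν (joint Y' (joint (Z k) A')) :=
      entropy_firstCopies_succ hP hA hPA k (fun q => (q.1.2, q.2)) (by unfold joint; fun_prop)
        (by simp [joint, copiesSnoc_eq_copiesSnoc_iff, Y', Z, A']; tauto)
    simp only [condMutualInfo, condEntropy, a1, a2, a3, a4]
  have l2 : ∀ k, condMutualInfo ν (Z (k + 1)) X' Y' = condMutualInfo ν (joint (Z k) A') X' Y' ∧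
      condMutualInfo ν (Z (k + 1)) Y' X' = condMutualInfo ν (joint (Z k) A') Y' X' := by
    intro k
    have := mZ k
    have a1 : entropy ν (joint (Z (k + 1)) X') = entropy ν (joint (joint (Z k) A') X') :=
      entropy_firstCopies_succ hP hA hPA k (fun q => (q.2, q.1.1)) (by unfold joint; fun_prop)
        (by simp [joint, copiesSnoc_eq_copiesSnoc_iff, X', Z, A']; tauto)
    have a2 : entropy ν (joint (Z (k + 1)) Y') = entropy ν (joint (joint (Z k) A') Y') :=
      entropy_firstCopies_succ hP hA hPA k (fun q => (q.2, q.1.2)) (by unfold joint; fun_prop)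
        (by simp [joint, copiesSnoc_eq_copiesSnoc_iff, Y', Z, A']; tauto)
    have a3 : entropy ν (joint (Z (k + 1)) (joint X' Y')) =
        entropy ν (joint (joint (Z k) A') (joint X' Y')) :=
      entropy_firstCopies_succ hP hA hPA k (fun q => (q.2, q.1))
        (by unfold joint; fun_prop)
        (by simp [joint, copiesSnoc_eq_copiesSnoc_iff, X', Y', Z, A']; tauto)
    have a4 : entropy ν (joint (Z (k + 1)) (joint Y' X')) =
        entropy ν (joint (joint (Z k) A') (joint Y' X')) :=
      entropy_firstCopies_succ hP hA hPA k (fun q => (q.2, q.1.2, q.1.1))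
        (by unfold joint; fun_prop)
        (by simp [joint, copiesSnoc_eq_copiesSnoc_iff, X', Y', Z, A']; tauto)
    simp only [condMutualInfo, condEntropy, a1, a2, a3, a4, and_self]
  have hpair := fun k => condMutualInfo_pair_le mX mY mA (mZ k) (fEA k) (e2 k)
  have hm0 := mZ 0
  -- `Z 0` takes values in a one-point type, so it drops out of every entropy; this starts both
  -- inductions below.
  have z1 : entropy ν (joint (Z 0) X') = entropy ν X' :=
    entropy_congr ((fE 0).of_determined (mE 0) (by unfold joint; fun_prop)
      (by simp +contextual [joint])) (by unfold joint; fun_prop) mX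
      (by simp [joint, eq_iff_true_of_subsingleton])
  have z2 : entropy ν (joint (Z 0) Y') = entropy ν Y' :=
    entropy_congr ((fE 0).of_determined (mE 0) (by unfold joint; fun_prop)
      (by simp +contextual [joint])) (by unfold joint; fun_prop) mY
      (by simp [joint, eq_iff_true_of_subsingleton])
  have z3 : entropy ν (joint (Z 0) (joint X' Y')) = entropy ν (joint X' Y') :=
    entropy_congr ((fE 0).of_determined (mE 0) (by unfold joint; fun_prop)
      (by simp +contextual [joint])) (by unfold joint; fun_prop) (by unfold joint; fun_prop)
      (by simp [joint, eq_iff_true_of_subsingleton])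
  have z4 : entropy ν (joint (Z 0) (joint Y' X')) = entropy ν (joint Y' X') :=
    entropy_congr ((fE 0).of_determined (mE 0) (by unfold joint; fun_prop)
      (by simp +contextual [joint])) (by unfold joint; fun_prop) (by unfold joint; fun_prop)
      (by simp [joint, eq_iff_true_of_subsingleton])
  have z5 : entropy ν (joint X' (Z 0)) = entropy ν X' :=
    entropy_congr ((fE 0).of_determined (mE 0) (by unfold joint; fun_prop)
      (by simp +contextual [joint])) (by unfold joint; fun_prop) mX
      (by simp [joint, eq_iff_true_of_subsingleton])
  have z6 : entropy ν (joint Y' (Z 0)) = entropy ν Y' :=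
    entropy_congr ((fE 0).of_determined (mE 0) (by unfold joint; fun_prop)
      (by simp +contextual [joint])) (by unfold joint; fun_prop) mY
      (by simp [joint, eq_iff_true_of_subsingleton])
  have z7 : entropy ν (joint X' (joint Y' (Z 0))) = entropy ν (joint X' Y') :=
    entropy_congr ((fE 0).of_determined (mE 0) (by unfold joint; fun_prop)
      (by simp +contextual [joint])) (by unfold joint; fun_prop) (by unfold joint; fun_prop)
      (by simp [joint, eq_iff_true_of_subsingleton])
  have z8 : entropy ν (Z 0) = 0 := by
    have h1 : ∀ z : Fin 0 → U, Z 0 ⁻¹' {z} = Set.univ := fun z =>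
      Set.eq_univ_of_forall fun w => Subsingleton.elim _ _
    simp [entropy, h1]
  have hlin : ∀ k : ℕ, condMutualInfo ν (Z k) X' Y' + condMutualInfo ν (Z k) Y' X' ≤
      k * (condMutualInfo ν A' X' Y' + condMutualInfo ν A' Y' X') := by
    intro k
    induction k with
    | zero =>
      simp only [condMutualInfo, condEntropy, z1, z2, z3, z4]
      simp
    | succ k ih =>
      rw [(l2 k).1, (l2 k).2]
      push_cast
      linarith [(hpair k).1, (hpair k).2]
  -- The telescoped sum of `hmain` over `k < m`. Its last term stays on the left for the induction
  -- and is discarded afterwards by nonnegativity; the coefficient `m(m-1)/2` is the sum of the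
  -- bounds `k` from `hlin`.
  have hsum : ∀ m : ℕ, m * mutualInfo ν X' Y' + condMutualInfo ν X' Y' (Z m) ≤
      m * (condMutualInfo ν X' Y' A' + condMutualInfo ν X' Y' B' + mutualInfo ν A' B') +
        mutualInfo ν X' Y' +
        m * (m - 1) / 2 * (condMutualInfo ν A' X' Y' + condMutualInfo ν A' Y' X') := by
    intro m
    induction m with
    | zero =>
      simp only [condMutualInfo, mutualInfo, condEntropy, z5, z6, z7, z8]
      simp
    | succ m ih =>
      rw [l1 m]
      push_cast
      have h1 := hmain m
      have h2 := hlin m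
      linear_combination ih + h1 + h2
  have hnn : 0 ≤ condMutualInfo ν X' Y' (Z n) :=
    condMutualInfo_nonneg mX mY (mZ n) ((fE n).of_determined (mE n)
      (by have := mZ n; unfold joint; fun_prop) (by simp +contextual [joint]))
  have hfin := (le_add_of_nonneg_right hnn).trans (hsum n)
  rw [show mutualInfo ν X' Y' = mutualInfo μ X Y from mutualInfo_comp_fst hP hA hX hY,
    show mutualInfo ν A' B' = mutualInfo μ A B from mutualInfo_comp_fst hP hA hA hB,
    show condMutualInfo ν X' Y' A' = condMutualInfo μ X Y A from
      condMutualInfo_comp_fst hP hA hX hY hA,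
    show condMutualInfo ν X' Y' B' = condMutualInfo μ X Y B from
      condMutualInfo_comp_fst hP hA hX hY hB,
    show condMutualInfo ν A' X' Y' = condMutualInfo μ A X Y from
      condMutualInfo_comp_fst hP hA hA hX hY,
    show condMutualInfo ν A' Y' X' = condMutualInfo μ A Y X from
      condMutualInfo_comp_fst hP hA hA hY hX] at hfin
  exact hfin

end Iteration

/-! ### Choice of the number of copies and conclusion -/

/-- Optimization of the index in a sequence of bounds with error terms `x / n` and
`(n - 1) * (ε * x)`. -/
theorem le_add_sqrt_of_forall_nat {x y ε : ℝ} (hx : 0 ≤ x) (hε : 0 ≤ ε)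
    (h : ∀ n : ℕ, n * x ≤ n * y + x + n * (n - 1) * (ε * x)) :
    x ≤ y + 2 * Real.sqrt ε * x := by
  rcases hε.eq_or_lt with rfl | hpos
  · by_contra! hlt
    simp only [Real.sqrt_zero, mul_zero, zero_mul, add_zero] at hlt
    -- With `ε = 0` only the error `x / n` remains, and this `n` makes it smaller than the supposed
    -- gap `x - y`.
    obtain ⟨n, hn⟩ := exists_nat_gt (x / (x - y))
    rw [div_lt_iff₀ (sub_pos.2 hlt)] at hn
    linarith [h n]
  · have hs : 0 < Real.sqrt ε := Real.sqrt_pos.2 hpos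
    have hsq : Real.sqrt ε * Real.sqrt ε = ε := Real.mul_self_sqrt hε
    set s := Real.sqrt ε
    -- This choice balances the errors: `1/n ≤ s` and `(n-1) s² ≤ s`, each contributing one `√ε`.
    set n := ⌈1 / s⌉₊
    have h1 : 1 ≤ n * s := (div_le_iff₀ hs).1 (Nat.le_ceil (1 / s))
    have h2 : (n - 1 : ℝ) * s ≤ 1 := by
      have := Nat.ceil_lt_add_one (one_div_pos.2 hs).le
      exact (le_div_iff₀ hs).1 (by linarith)
    have hn : (0 : ℝ) < n := Nat.cast_pos.2 (Nat.ceil_pos.2 (one_div_pos.2 hs))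
    have h3 : x ≤ n * s * x := le_mul_of_one_le_left hx h1
    have h4 : n * (n - 1 : ℝ) * (ε * x) ≤ n * (s * x) := by
      calc n * (n - 1 : ℝ) * (ε * x) = (n - 1 : ℝ) * s * (n * (s * x)) := by rw [← hsq]; ring
        _ ≤ n * (s * x) := mul_le_of_le_one_left (by positivity) h2
    refine le_of_mul_le_mul_left ?_ hn
    linarith [h n]

end DiscreteEntropy

theorem theorem1 :
    ∃ C : ℝ, 0 < C ∧
      ∀ (Ω : Type*) [MeasurableSpace Ω] (μ : Measure Ω) [IsProbabilityMeasure μ]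
        (S T U V : Type*)
        [Countable S] [MeasurableSpace S] [MeasurableSingletonClass S]
        [Countable T] [MeasurableSpace T] [MeasurableSingletonClass T]
        [Countable U] [MeasurableSpace U] [MeasurableSingletonClass U]
        [Countable V] [MeasurableSpace V] [MeasurableSingletonClass V]
        (X : Ω → S) (Y : Ω → T) (A : Ω → U) (B : Ω → V),
        Measurable X → Measurable Y → Measurable A → Measurable B →
        DiscreteEntropy.HasFiniteEntropy μ
          (DiscreteEntropy.joint X (DiscreteEntropy.joint Y (DiscreteEntropy.joint A B))) →
        ∀ ε : ℝ, 0 ≤ ε →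
          max (DiscreteEntropy.condMutualInfo μ A X Y) (DiscreteEntropy.condMutualInfo μ A Y X)
            ≤ ε * DiscreteEntropy.mutualInfo μ X Y →
          DiscreteEntropy.mutualInfo μ X Y
            ≤ DiscreteEntropy.condMutualInfo μ X Y A + DiscreteEntropy.condMutualInfo μ X Y B
              + DiscreteEntropy.mutualInfo μ A B
              + C * Real.sqrt ε * DiscreteEntropy.mutualInfo μ X Y := by
  refine ⟨2, two_pos, ?_⟩
  intro Ω _ μ _ S T U V _ _ _ _ _ _ _ _ _ _ _ _ X Y A B hX hY hA hB hf ε hε h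
  have hE : Measurable (DiscreteEntropy.joint X
      (DiscreteEntropy.joint Y (DiscreteEntropy.joint A B))) := by
    unfold DiscreteEntropy.joint; fun_prop
  have hI := DiscreteEntropy.mutualInfo_nonneg (μ := μ) hX hY
    (hf.of_determined hE (DiscreteEntropy.measurable_joint hX hY)
      (by simp +contextual [DiscreteEntropy.joint]))
  refine DiscreteEntropy.le_add_sqrt_of_forall_nat hI hε fun n => ?_
  refine (DiscreteEntropy.nsmul_mutualInfo_le hX hY hA hB hf n).trans ?_
  -- The real factor `n - 1` is negative at `n = 0`, hence the separate case. The two bounds by `ε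
  -- I(X:Y)` then cancel the denominator `2`.
  have hn : (0 : ℝ) ≤ n * (n - 1) / 2 := by
    rcases n.eq_zero_or_pos with rfl | hn
    · simp
    · have : (1 : ℝ) ≤ n := Nat.one_le_cast.2 hn
      have : (0 : ℝ) ≤ n - 1 := sub_nonneg.2 this
      positivity
  have hsum := mul_le_mul_of_nonneg_left
    (add_le_add ((le_max_left _ _).trans h) ((le_max_right _ _).trans h)) hn
  linarith
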